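/- Let $(\mathbb X,d)$ be a nonempty compact metric space with diameter $D=\sup_{x,y\in\mathbb X}d(x,y)$, let $\mathbb Y$ be a Polish space (both with their Borel $\sigma$-fields), let $\mathcal T(dx'\mid x)$ be a stochastic kernel from $\mathbb X$ to $\mathbb X$ (the transition kernel of the hidden state) and $\mathcal Q(dy\mid x)$ a stochastic kernel from $\mathbb X$ to $\mathbb Y$ (the observation channel). Let $\mathcal Z=\mathcal P(\mathbb X)$ be the space of Borel probability measures on $\mathbb X$ with the weak topology and its Borel $\sigma$-field. The filter process is the Markov chain on $\mathcal Z$ with transition kernel $$\eta(A\mid z)=\int_{\mathbb X}\int_{\mathbb X}\int_{\mathbb Y}\mathbf 1\{F(z,y_1)\in A\}\,\mathcal Q(dy_1\mid x_1)\,\mathcal T(dx_1\mid x_0)\,z(dx_0),$$ where, for $z\in\mathcal Z$, $F(z,y)=\Pr\{X_1\in\cdot\mid Y_1=y\}$ is a regular conditional distribution of $X_1$ given $Y_1$, jointly measurable in $(z,y)$, when $X_0\sim z$, $X_1\sim\mathcal T(\cdot\mid X_0)$ and $Y_1\sim\mathcal Q(\cdot\mid X_1)$. For $\mu\in\mathcal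 P(\mathcal Z)$ write $\eta^n(\cdot\mid\mu)=\int\eta^n(\cdot\mid z)\,\mu(dz)$. For probability measures put $\|\mu-\nu\|_{TV}=\sup\{\int g\,d\mu-\int g\,d\nu: g\text{ measurable},\ \|g\|_\infty\le1\}$, and let $W_1(\mu,\nu)=\sup\{\int f\,d\mu-\int f\,d\nu\}$, the supremum being over all real functions $f$ that are $1$-Lipschitz: with respect to $d$ for measures on $\mathbb X$, and with respect to the metric $W_1$ of $\mathcal Z$ for measures on $\mathcal Z$. The Dobrushin coefficient of $\mathcal Q$ is $$\delta(\mathcal Q)=\inf\sum_{i=1}^n\min\{\mathcal Q(A_i\mid x),\mathcal Q(A_i\mid x')\},$$ the infimum being over all $x,x'\in\mathbb X$ and all finite measurable partitions $\{A_i\}_{i=1}^n$ of $\mathbb Y$. **Theorem (Geometric Ergodicity).** Assume that there is $\alpha\ge0$ such that $\|\mathcal T(\cdot\mid x)-\mathcal T(\cdot\mid x')\|_{TV}\le\alpha\,d(x,x')$ for all $x,x'\in\mathbb X$, and that $\alpha D(3-2\delta(\mathcal Q))<2$. Then the filter process is uniformly geometrically Wasserstein ergodic: there are $\pi\in\mathcal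 P(\mathcal Z)$ and $\rho>1$ with $$\sup_{z\in\mathcal Z}\rho^n\,W_1(\eta^n(\cdot\mid z),\pi)\to0\qquad(n\to\infty).$$ Moreover, $\eta$ has an invariant probability measure, and with $\beta=\alpha D(3-2\delta(\mathcal Q))/2<1$, $$W_1(\eta^n(\cdot\mid\mu),\eta^n(\cdot\mid\nu))\le\beta^nD\qquad\text{for all }\mu,\nu\in\mathcal P(\mathcal Z)\text{ and }n\ge0.$$ -/

import Mathlib

open MeasureTheory ProbabilityTheory Filter Topology

namespace NonlinearFilter

/-- The total variation norm `‖μ - ν‖_TV = sup {∫ g dμ - ∫ g dν : g measurable, ‖g‖_∞ ≤ 1}` of the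
difference of two probability measures. With this normalization its maximal value is `2`. -/
noncomputable def tvDist {S : Type*} [MeasurableSpace S] (μ ν : Measure S) : ℝ :=
  sSup {r : ℝ | ∃ g : S → ℝ, Measurable g ∧ (∀ x, |g x| ≤ 1) ∧ r = ∫ x, g x ∂μ - ∫ x, g x ∂ν}

/-- The Dobrushin coefficient `δ(K) = inf ∑ᵢ min {K(x, Aᵢ), K(y, Aᵢ)}`, the infimum being over all
pairs of points `x, y` and all finite measurable partitions `A₁, …, Aₙ` of the target space. -/
noncomputable def dobrushin {S₁ S₂ : Type*} [MeasurableSpace S₁] [MeasurableSpace S₂]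
    (K : Kernel S₁ S₂) : ℝ :=
  sInf {r : ℝ | ∃ (x y : S₁) (n : ℕ) (A : Fin n → Set S₂),
    (∀ i, MeasurableSet (A i)) ∧ Pairwise (fun i j => Disjoint (A i) (A j)) ∧
    (⋃ i, A i) = Set.univ ∧ r = ∑ i, min ((K x).real (A i)) ((K y).real (A i))}

/-- The Wasserstein distance of order one, in its Kantorovich-Rubinstein form
`W₁(μ, ν) = sup {∫ f dμ - ∫ f dν : |f x - f y| ≤ d(x, y) for all x, y}`,
on a space with distance function `d`. -/
noncomputable def W1 {S : Type*} [MeasurableSpace S] (d : S → S → ℝ) (μ ν : Measure S) : ℝ :=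
  sSup {r : ℝ | ∃ f : S → ℝ, (∀ x y, |f x - f y| ≤ d x y) ∧ r = ∫ x, f x ∂μ - ∫ x, f x ∂ν}

/-- The law `P^n(· | μ) = ∫ P^n(· | x) μ(dx)` after `n` steps of a Markov chain with transition kernel
`P` and initial law `μ`. -/
noncomputable def stepLaw {S : Type*} [MeasurableSpace S] (P : Kernel S S) (n : ℕ)
    (μ : Measure S) : Measure S :=
  Measure.bind μ (P ^ n : Kernel S S)

/-- A transition kernel `P` on a space with distance function `d` is (uniformly) geometrically
Wasserstein ergodic if there are a probability measure `π` and `ρ > 1` with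
`sup_x ρ^n W₁(P^n(· | δ_x), π) → 0` as `n → ∞`. -/
def GeometricallyWassersteinErgodic {S : Type*} [MeasurableSpace S] (d : S → S → ℝ)
    (P : Kernel S S) : Prop :=
  ∃ (π : ProbabilityMeasure S) (ρ : ℝ), 1 < ρ ∧
    Tendsto (fun n : ℕ => ⨆ x : S, ENNReal.ofReal (ρ ^ n * W1 d (stepLaw P n (Measure.dirac x)) π))
      atTop (𝓝 0)

section Filter

variable {X Y : Type*} [MeasurableSpace X] [MeasurableSpace Y]

/-- The distance `W₁` on the space of probability measures on a metric space. -/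
noncomputable def priorDist [MetricSpace X] (z z' : ProbabilityMeasure X) : ℝ :=
  W1 (fun x y : X => dist x y) (z : Measure X) (z' : Measure X)

/-- The identity `z ↦ z`, seen as a kernel from the space of probability measures on `X` to `X`. -/
noncomputable def evalKernel (X : Type*) [MeasurableSpace X] : Kernel (ProbabilityMeasure X) X where
  toFun z := (z : Measure X)
  measurable' := measurable_subtype_coe

instance : IsMarkovKernel (evalKernel X) :=
  ⟨fun z => inferInstanceAs (IsProbabilityMeasure (z : Measure X))⟩

/-- The law `∫ T(· | x) z(dx)` of the next hidden state when the present one has law `z`. -/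
noncomputable def predictor (T : Kernel X X) : Kernel (ProbabilityMeasure X) X :=
  T ∘ₖ evalKernel X

instance (T : Kernel X X) [IsMarkovKernel T] : IsMarkovKernel (predictor T) := by
  unfold predictor; infer_instance

/-- The joint law of the next observation and the next hidden state when the present hidden state
has law `z`: its value on `B` is `∫∫∫ 1_B(y₁, x₁) Q(dy₁ | x₁) T(dx₁ | x₀) z(dx₀)`. -/
noncomputable def jointLaw (T : Kernel X X) (Q : Kernel X Y) :
    Kernel (ProbabilityMeasure X) (Y × X) :=
  (predictor T ⊗ₖ Q.prodMkLeft (ProbabilityMeasure X)).map Prod.swap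

instance (T : Kernel X X) [IsMarkovKernel T] (Q : Kernel X Y) [IsMarkovKernel Q] :
    IsMarkovKernel (jointLaw T Q) := by
  unfold jointLaw; exact Kernel.IsMarkovKernel.map _ measurable_swap

variable [StandardBorelSpace X] [Nonempty X] [MeasurableSpace.CountablyGenerated Y]

/-- The filter update `F(z, y) = Pr {X₁ ∈ · | Z₀ = z, Y₁ = y}`: the regular conditional law of the
next hidden state given that the next observation is `y`, when the present state has law `z`. -/
noncomputable def filterUpdate (T : Kernel X X) [IsMarkovKernel T] (Q : Kernel X Y)
    [IsMarkovKernel Q] (z : ProbabilityMeasure X) (y : Y) : ProbabilityMeasure X :=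
  ⟨(jointLaw T Q).condKernel (z, y), inferInstance⟩

lemma measurable_filterUpdate (T : Kernel X X) [IsMarkovKernel T] (Q : Kernel X Y)
    [IsMarkovKernel Q] :
    Measurable (fun p : ProbabilityMeasure X × Y => filterUpdate T Q p.1 p.2) :=
  Measurable.subtype_mk (jointLaw T Q).condKernel.measurable

/-- The transition kernel `η` of the filter process:
`η(A | z) = ∫∫∫ 1{F(z, y₁) ∈ A} Q(dy₁ | x₁) T(dx₁ | x₀) z(dx₀)`, that is, the law of `F(z, Y₁)`
where `Y₁` is the next observation when the present hidden state has law `z`. -/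
noncomputable def filterKernel (T : Kernel X X) [IsMarkovKernel T] (Q : Kernel X Y)
    [IsMarkovKernel Q] : Kernel (ProbabilityMeasure X) (ProbabilityMeasure X) where
  toFun z := ((Q ∘ₖ predictor T) z).map (filterUpdate T Q z)
  measurable' := by
    have hF := measurable_filterUpdate T Q
    have h : (fun z => ((Q ∘ₖ predictor T) z).map (filterUpdate T Q z)) =
        fun z => ((Kernel.id ×ₖ (Q ∘ₖ predictor T)).map
          (fun p : ProbabilityMeasure X × Y => filterUpdate T Q p.1 p.2)) z := by
      funext z
      rw [Kernel.map_apply _ hF, Kernel.prod_apply, Kernel.id_apply, Measure.dirac_prod,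
        Measure.map_map hF (by fun_prop)]
      rfl
    rw [h]
    exact Kernel.measurable _

instance (T : Kernel X X) [IsMarkovKernel T] (Q : Kernel X Y) [IsMarkovKernel Q] :
    IsMarkovKernel (filterKernel T Q) :=
  ⟨fun _ => Measure.isProbabilityMeasure_map
    ((measurable_filterUpdate T Q).comp measurable_prodMk_left).aemeasurable⟩

end Filter

end NonlinearFilter

/-! The filter kernel contracts the Wasserstein distance by `β`, and everything else follows by
duality and compactness. Write `P z` for the law of the next observation under the prior `z`, and `τ
= α * priorDist z z'`. Test functions integrated against `T` become `α`-Lipschitz, so the predictors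
from `z` and `z'` are within `τ` in total variation, and their images under `Q` within `(1 - δ) τ`.

For a 1-Lipschitz `f` on priors, split the difference of the integrals of `f` into a change of
observation law, with the update `F(z', ·)` fixed, and a change of update, with `P z` fixed. The
first costs `D / 2 * (1 - δ) τ`, since `f` has oscillation at most `D`. The second is at most the `P
z`-mean of `W₁(F(z, y), F(z', y))`. A measurable choice of nearly optimal test functions, bounded by
`D / 2`, turns that mean into a comparison of joint laws (cost `τ`) plus another change of
observation law (cost `(1 - δ) τ`). The total is `β * priorDist z z'`: see
`integral_filterUpdate_sub_le` and `integral_filterKernel_sub_le`.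

Iterating gives the bound `β ^ n * D`. Weak compactness then supplies a limit point of the laws,
which the contraction shows to be invariant. -/

namespace NonlinearFilter


/-! ### Oscillation, total variation and the Dobrushin coefficient -/

section BoundedOscillation

variable {S S' : Type*} [MeasurableSpace S] [MeasurableSpace S']

/-- Centring at the middle of the range is the source of every factor `1 / 2`: constants cancel in a
difference of integrals against probability measures. -/
lemma exists_abs_sub_le_half_of_sub_le {S : Type*} [Nonempty S] {h : S → ℝ} {c : ℝ}
    (hc : ∀ x y, h x - h y ≤ c) : ∃ m, ∀ x, |h x - m| ≤ c / 2 := by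
  obtain ⟨x₀⟩ := ‹Nonempty S›
  have hA : BddAbove (Set.range h) := ⟨h x₀ + c, by rintro _ ⟨x, rfl⟩; linarith [hc x x₀]⟩
  have hne : (Set.range h).Nonempty := ⟨_, x₀, rfl⟩
  refine ⟨sSup (Set.range h) - c / 2, fun x => abs_le.2 ⟨?_, ?_⟩⟩
  · have : sSup (Set.range h) ≤ h x + c := by
      refine csSup_le hne ?_
      rintro _ ⟨y, rfl⟩
      linarith [hc y x]
    linarith
  · linarith [le_csSup hA ⟨x, rfl⟩]

lemma integrable_of_abs_le {μ : Measure S} [IsFiniteMeasure μ] {g : S → ℝ} {c : ℝ}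
    (hg : Measurable g) (hc : ∀ x, |g x| ≤ c) : Integrable g μ :=
  Integrable.of_bound hg.aestronglyMeasurable c (ae_of_all _ hc)

lemma abs_integral_le_of_abs_le {μ : Measure S} [IsProbabilityMeasure μ] {g : S → ℝ} {c : ℝ}
    (hc : ∀ x, |g x| ≤ c) : |∫ x, g x ∂μ| ≤ c := by
  simpa using norm_integral_le_of_norm_le_const (μ := μ) (f := g) (ae_of_all _ hc)

lemma integral_sub_integral_sub_const {μ ν : Measure S} [IsProbabilityMeasure μ]
    [IsProbabilityMeasure ν] {h : S → ℝ} (hμ : Integrable h μ) (hν : Integrable h ν) (m : ℝ) :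
    ∫ x, (h x - m) ∂μ - ∫ x, (h x - m) ∂ν = ∫ x, h x ∂μ - ∫ x, h x ∂ν := by
  rw [integral_sub hμ (integrable_const _), integral_sub hν (integrable_const _)]
  simp

lemma exists_abs_le_of_sub_le {S : Type*} [Nonempty S] {h : S → ℝ} {c : ℝ}
    (hc : ∀ x y, h x - h y ≤ c) : ∃ C, ∀ x, |h x| ≤ C := by
  obtain ⟨m, hb⟩ := exists_abs_sub_le_half_of_sub_le hc
  refine ⟨c / 2 + |m|, fun x => ?_⟩
  have := abs_add_le (h x - m) m
  rw [sub_add_cancel] at this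
  linarith [hb x]

lemma integrable_of_sub_le {μ : Measure S} [IsFiniteMeasure μ] [Nonempty S] {h : S → ℝ} {c : ℝ}
    (hm : Measurable h) (hc : ∀ x y, h x - h y ≤ c) : Integrable h μ :=
  have ⟨_, hC⟩ := exists_abs_le_of_sub_le hc
  integrable_of_abs_le hm hC

/-- Integrals of a function of oscillation at most `c` differ by at most `c`. -/
lemma integral_sub_integral_le_of_sub_le {μ ν : Measure S} [IsProbabilityMeasure μ]
    [IsProbabilityMeasure ν] [Nonempty S] {h : S → ℝ} {c : ℝ} (hm : Measurable h)
    (hc : ∀ x y, h x - h y ≤ c) : ∫ x, h x ∂μ - ∫ x, h x ∂ν ≤ c := by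
  obtain ⟨m, hb⟩ := exists_abs_sub_le_half_of_sub_le hc
  rw [← integral_sub_integral_sub_const (integrable_of_sub_le hm hc)
    (integrable_of_sub_le hm hc) m]
  have h1 := abs_le.1 (abs_integral_le_of_abs_le (μ := μ) hb)
  have h2 := abs_le.1 (abs_integral_le_of_abs_le (μ := ν) hb)
  linarith

/-- A dual bound on bounded functions by `τ` scales to functions bounded by `c`. -/
lemma integral_sub_integral_le_mul {μ ν : Measure S} {τ : ℝ}
    (hτ : ∀ g : S → ℝ, Measurable g → (∀ x, |g x| ≤ 1) → ∫ x, g x ∂μ - ∫ x, g x ∂ν ≤ τ)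
    {h : S → ℝ} (hm : Measurable h) {c : ℝ} (hc : 0 ≤ c) (hb : ∀ x, |h x| ≤ c) :
    ∫ x, h x ∂μ - ∫ x, h x ∂ν ≤ c * τ := by
  rcases hc.eq_or_lt with rfl | hc
  · have : h = 0 := funext fun x => abs_nonpos_iff.1 (hb x)
    simp [this]
  · have := hτ (fun x => c⁻¹ * h x) (hm.const_mul _) fun x => by
      rw [abs_mul, abs_of_pos (inv_pos.2 hc), inv_mul_le_iff₀ hc, mul_one]
      exact hb x
    rw [integral_const_mul, integral_const_mul, ← mul_sub, inv_mul_le_iff₀ hc] at this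
    exact this

/-- If two probability measures differ by at most `c` on every measurable set, then the integrals
of a function with values in `[-1, 1]` differ by at most `2 c`. -/
lemma integral_sub_integral_le_two_mul {μ ν : Measure S} [IsProbabilityMeasure μ]
    [IsProbabilityMeasure ν] {c : ℝ}
    (hc : ∀ A, MeasurableSet A → μ.real A - ν.real A ≤ c)
    {g : S → ℝ} (hg : Measurable g) (hb : ∀ x, |g x| ≤ 1) :
    ∫ x, g x ∂μ - ∫ x, g x ∂ν ≤ 2 * c := by
  -- On `s`, where `ν ≤ μ`, compare the integrals of `1 - g ≥ 0`; on the complement those of `1 + g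
  -- ≥ 0`. Each part contributes at most `μ s - ν s`.
  obtain ⟨s, hs⟩ := exists_isHahnDecomposition ν μ
  have hsm := hs.measurableSet
  have hI : ∀ (ρ : Measure S) [IsFiniteMeasure ρ], Integrable g ρ := fun ρ _ =>
    integrable_of_abs_le hg hb
  have h1 : ∫ x in s, (1 - g x) ∂ν ≤ ∫ x in s, (1 - g x) ∂μ :=
    integral_mono_measure hs.le_on
      (ae_of_all _ fun x => sub_nonneg.2 (abs_le.1 (hb x)).2)
      ((integrable_const _).sub (hI _))
  have h2 : ∫ x in sᶜ, (1 + g x) ∂μ ≤ ∫ x in sᶜ, (1 + g x) ∂ν :=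
    integral_mono_measure hs.ge_on_compl
      (ae_of_all _ fun x => by simpa using by linarith [(abs_le.1 (hb x)).1])
      ((integrable_const _).add (hI _))
  rw [integral_sub (integrable_const _) (hI _), integral_sub (integrable_const _) (hI _)] at h1
  rw [integral_add (integrable_const _) (hI _), integral_add (integrable_const _) (hI _)] at h2
  simp only [integral_const, smul_eq_mul, mul_one, measureReal_restrict_apply_univ] at h1 h2
  rw [probReal_compl_eq_one_sub hsm, probReal_compl_eq_one_sub hsm] at h2
  rw [← integral_add_compl hsm (hI μ), ← integral_add_compl hsm (hI ν)]
  linarith [hc s hsm]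

lemma dobrushin_bddBelow (K : Kernel S S') : BddBelow {r : ℝ | ∃ (x y : S) (n : ℕ)
    (A : Fin n → Set S'), (∀ i, MeasurableSet (A i)) ∧ Pairwise (fun i j => Disjoint (A i) (A j)) ∧
    (⋃ i, A i) = Set.univ ∧ r = ∑ i, min ((K x).real (A i)) ((K y).real (A i))} := by
  refine ⟨0, ?_⟩
  rintro _ ⟨x, y, n, A, -, -, -, rfl⟩
  exact Finset.sum_nonneg fun i _ => le_min measureReal_nonneg measureReal_nonneg

/-- Two-set partitions `{A, Aᶜ}` suffice: bound the minimum by `K y` on `A` and by `K x` on `Aᶜ`. -/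
lemma measureReal_sub_le_one_sub_dobrushin (K : Kernel S S') [IsMarkovKernel K] (x y : S)
    {A : Set S'} (hA : MeasurableSet A) :
    (K x).real A - (K y).real A ≤ 1 - dobrushin K := by
  have h : dobrushin K ≤ min ((K x).real A) ((K y).real A) +
      min ((K x).real Aᶜ) ((K y).real Aᶜ) := by
    refine csInf_le (dobrushin_bddBelow K) ⟨x, y, 2, ![A, Aᶜ], ?_, ?_, ?_, ?_⟩
    · intro i; fin_cases i <;> simp [hA]
    · intro i j hij
      fin_cases i <;> fin_cases j <;> simp_all [disjoint_compl_right, disjoint_compl_left]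
    · ext z
      simpa [Fin.exists_fin_two] using em (z ∈ A)
    · simp [Fin.sum_univ_two]
  rw [probReal_compl_eq_one_sub hA, probReal_compl_eq_one_sub hA] at h
  have h1 := min_le_right ((K x).real A) ((K y).real A)
  have h2 := min_le_left (1 - (K x).real A) (1 - (K y).real A)
  linarith

lemma dobrushin_le_one [Nonempty S] (K : Kernel S S') [IsMarkovKernel K] : dobrushin K ≤ 1 := by
  obtain ⟨x⟩ := ‹Nonempty S›
  have := measureReal_sub_le_one_sub_dobrushin K x x MeasurableSet.empty
  linarith

/-- A Markov kernel contracts the total variation distance by the factor `1 - δ(K)`. -/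
lemma integral_integral_sub_le_dobrushin [Nonempty S] (K : Kernel S S') [IsMarkovKernel K]
    {μ ν : Measure S} [IsProbabilityMeasure μ] [IsProbabilityMeasure ν] {τ : ℝ}
    (hτ : ∀ g : S → ℝ, Measurable g → (∀ x, |g x| ≤ 1) → ∫ x, g x ∂μ - ∫ x, g x ∂ν ≤ τ)
    {g : S' → ℝ} (hg : Measurable g) (hb : ∀ y, |g y| ≤ 1) :
    ∫ x, ∫ y, g y ∂K x ∂μ - ∫ x, ∫ y, g y ∂K x ∂ν ≤ (1 - dobrushin K) * τ := by
  have hm : Measurable fun x => ∫ y, g y ∂K x :=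
    (hg.stronglyMeasurable.integral_kernel (κ := K)).measurable
  have hc : ∀ x x', (∫ y, g y ∂K x) - ∫ y, g y ∂K x' ≤ 2 * (1 - dobrushin K) := fun x x' =>
    integral_sub_integral_le_two_mul
      (fun A hA => measureReal_sub_le_one_sub_dobrushin K x x' hA) hg hb
  -- The averaged function has oscillation at most `2 (1 - δ)`, so after centring it is bounded by
  -- `1 - δ`.
  obtain ⟨m, hm'⟩ := exists_abs_sub_le_half_of_sub_le hc
  rw [← integral_sub_integral_sub_const (integrable_of_sub_le hm hc)
    (integrable_of_sub_le hm hc) m]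
  refine integral_sub_integral_le_mul hτ (hm.sub_const m)
    (sub_nonneg.2 (dobrushin_le_one K)) fun x => (hm' x).trans_eq (by ring)

end BoundedOscillation


/-! ### The Wasserstein distance and the weak topology on priors -/

section PriorDist

set_option linter.unusedSectionVars false

variable {X : Type*} [MetricSpace X] [CompactSpace X] [Nonempty X] [MeasurableSpace X] [BorelSpace X]

instance : Nonempty (ProbabilityMeasure X) :=
  have ⟨x⟩ := ‹Nonempty X›
  ⟨⟨Measure.dirac x, inferInstance⟩⟩

lemma dist_le_diam_univ (x y : X) : dist x y ≤ Metric.diam (Set.univ : Set X) :=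
  Metric.dist_le_diam_of_mem (Metric.isBounded_of_compactSpace) trivial trivial

lemma continuous_of_abs_sub_le_dist {f : X → ℝ} (hf : ∀ x y, |f x - f y| ≤ dist x y) :
    Continuous f :=
  (LipschitzWith.of_dist_le_mul (K := 1) fun x y => by simpa [Real.dist_eq] using hf x y).continuous

lemma measurable_of_abs_sub_le_dist {f : X → ℝ} (hf : ∀ x y, |f x - f y| ≤ dist x y) :
    Measurable f :=
  (continuous_of_abs_sub_le_dist hf).measurable

lemma sub_le_diam_of_abs_sub_le_dist {f : X → ℝ} (hf : ∀ x y, |f x - f y| ≤ dist x y) (x y : X) :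
    f x - f y ≤ Metric.diam (Set.univ : Set X) :=
  (le_abs_self _).trans ((hf x y).trans (dist_le_diam_univ x y))

lemma integral_sub_integral_le_priorDist (z z' : ProbabilityMeasure X) {f : X → ℝ}
    (hf : ∀ x y, |f x - f y| ≤ dist x y) :
    ∫ x, f x ∂(z : Measure X) - ∫ x, f x ∂(z' : Measure X) ≤ priorDist z z' := by
  refine le_csSup ⟨Metric.diam (Set.univ : Set X), ?_⟩ ⟨f, hf, rfl⟩
  rintro _ ⟨g, hg, rfl⟩
  exact integral_sub_integral_le_of_sub_le (measurable_of_abs_sub_le_dist hg)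
    (sub_le_diam_of_abs_sub_le_dist hg)

lemma priorDist_le {z z' : ProbabilityMeasure X} {c : ℝ}
    (h : ∀ f : X → ℝ, (∀ x y, |f x - f y| ≤ dist x y) →
      ∫ x, f x ∂(z : Measure X) - ∫ x, f x ∂(z' : Measure X) ≤ c) : priorDist z z' ≤ c := by
  refine csSup_le ⟨_, fun _ => 0, fun x y => by simp, rfl⟩ ?_
  rintro _ ⟨g, hg, rfl⟩
  exact h g hg

lemma priorDist_nonneg (z z' : ProbabilityMeasure X) : 0 ≤ priorDist z z' := by
  simpa using integral_sub_integral_le_priorDist z z' (f := fun _ => 0) (by simp)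

lemma priorDist_self (z : ProbabilityMeasure X) : priorDist z z = 0 :=
  (priorDist_le fun f _ => by simp).antisymm (priorDist_nonneg z z)

lemma priorDist_comm_le (z z' : ProbabilityMeasure X) : priorDist z z' ≤ priorDist z' z :=
  priorDist_le fun f hf => by
    have := integral_sub_integral_le_priorDist z' z (f := fun x => - f x) fun x y => by
      rw [neg_sub_neg, abs_sub_comm]; exact hf x y
    simp only [integral_neg] at this
    linarith

lemma priorDist_comm (z z' : ProbabilityMeasure X) : priorDist z z' = priorDist z' z :=
  (priorDist_comm_le z z').antisymm (priorDist_comm_le z' z)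

lemma priorDist_triangle (z₁ z₂ z₃ : ProbabilityMeasure X) :
    priorDist z₁ z₃ ≤ priorDist z₁ z₂ + priorDist z₂ z₃ :=
  priorDist_le fun f hf => by
    linarith [integral_sub_integral_le_priorDist z₁ z₂ hf,
      integral_sub_integral_le_priorDist z₂ z₃ hf]

lemma priorDist_le_diam (z z' : ProbabilityMeasure X) :
    priorDist z z' ≤ Metric.diam (Set.univ : Set X) :=
  priorDist_le fun _ hf => integral_sub_integral_le_of_sub_le (measurable_of_abs_sub_le_dist hf)
    (sub_le_diam_of_abs_sub_le_dist hf)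

/-- The `1`-Lipschitz functions bounded by half the diameter. -/
def lipBall (X : Type*) [MetricSpace X] : Set (BoundedContinuousFunction X ℝ) :=
  {f | (∀ x y, |f x - f y| ≤ dist x y) ∧ ∀ x, |f x| ≤ Metric.diam (Set.univ : Set X) / 2}

/-- Arzelà–Ascoli. This compactness gives both countably many sufficient test functions and the
uniformity that makes weak convergence imply `W₁` convergence. -/
lemma isCompact_lipBall : IsCompact (lipBall X) := by
  have hc : ∀ x : X, Continuous fun f : BoundedContinuousFunction X ℝ => f x := fun x =>
    continuous_eval_const x
  refine BoundedContinuousFunction.arzela_ascoli₂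
    (Set.Icc (-(Metric.diam (Set.univ : Set X) / 2)) (Metric.diam (Set.univ : Set X) / 2))
    isCompact_Icc _ ?_ (fun f x hf => abs_le.1 (hf.2 x)) ?_
  · have : lipBall X = (⋂ x, ⋂ y, {f | |f x - f y| ≤ dist x y}) ∩
        ⋂ x, {f | |f x| ≤ Metric.diam (Set.univ : Set X) / 2} := by
      ext f; simp [lipBall]
    rw [this]
    exact (isClosed_iInter fun x => isClosed_iInter fun y =>
      isClosed_le ((hc x).sub (hc y)).abs continuous_const).inter
      (isClosed_iInter fun x => isClosed_le (hc x).abs continuous_const)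
  · exact (LipschitzWith.uniformEquicontinuous _ 1 fun f =>
      LipschitzWith.of_dist_le_mul fun x y => by
        simpa [Real.dist_eq] using f.2.1 x y).equicontinuous

lemma exists_mem_lipBall {f : X → ℝ} (hf : ∀ x y, |f x - f y| ≤ dist x y) :
    ∃ g ∈ lipBall X, ∃ m, ∀ x, g x = f x - m := by
  obtain ⟨m, hm⟩ := exists_abs_sub_le_half_of_sub_le (sub_le_diam_of_abs_sub_le_dist hf)
  exact ⟨BoundedContinuousFunction.mkOfCompact
    ⟨fun x => f x - m, (continuous_of_abs_sub_le_dist hf).sub continuous_const⟩,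
    ⟨fun x y => by simpa using hf x y, hm⟩, m, fun x => rfl⟩

lemma exists_mem_lipBall_integral_sub_eq (z z' : ProbabilityMeasure X) {f : X → ℝ}
    (hf : ∀ x y, |f x - f y| ≤ dist x y) :
    ∃ g ∈ lipBall X, ∫ x, g x ∂(z : Measure X) - ∫ x, g x ∂(z' : Measure X) =
      ∫ x, f x ∂(z : Measure X) - ∫ x, f x ∂(z' : Measure X) := by
  obtain ⟨g, hg, m, hm⟩ := exists_mem_lipBall hf
  refine ⟨g, hg, ?_⟩
  simp only [hm]
  exact integral_sub_integral_sub_const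
    (integrable_of_sub_le (measurable_of_abs_sub_le_dist hf) (sub_le_diam_of_abs_sub_le_dist hf))
    (integrable_of_sub_le (measurable_of_abs_sub_le_dist hf) (sub_le_diam_of_abs_sub_le_dist hf)) m

lemma integral_le_integral_add_dist (z : ProbabilityMeasure X) (f g : BoundedContinuousFunction X ℝ) :
    ∫ x, f x ∂(z : Measure X) ≤ ∫ x, g x ∂(z : Measure X) + dist f g := by
  have h : ∫ x, f x ∂(z : Measure X) ≤ ∫ x, (g x + dist f g) ∂(z : Measure X) := by
    refine integral_mono (f.integrable _) ((g.integrable _).add (integrable_const _)) fun x => ?_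
    have := (le_abs_self _).trans (f.dist_coe_le_dist (g := g) x)
    simp only [] at this ⊢
    linarith
  rwa [integral_add (g.integrable _) (integrable_const _), integral_const, probReal_univ,
    one_smul] at h

/-- A sequence dense in the compact `lipBall X` nearly attains every `W₁` distance. Countability
serves the measurable selection and the embedding of the priors into `ℕ → ℝ`. -/
lemma exists_countable_lipBall (X : Type*) [MetricSpace X] [CompactSpace X] [Nonempty X]
    [MeasurableSpace X] [BorelSpace X] : ∃ u : ℕ → BoundedContinuousFunction X ℝ,
    (∀ k, u k ∈ lipBall X) ∧ ∀ (z z' : ProbabilityMeasure X) (c : ℝ), c < priorDist z z' →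
      ∃ k, c < ∫ x, u k x ∂(z : Measure X) - ∫ x, u k x ∂(z' : Measure X) := by
  have : CompactSpace (lipBall X) := isCompact_iff_compactSpace.1 isCompact_lipBall
  have : Nonempty (lipBall X) :=
    ⟨0, fun x y => by simp, fun x => by
      simpa using div_nonneg (Metric.diam_nonneg (s := (Set.univ : Set X))) zero_le_two⟩
  refine ⟨fun k => TopologicalSpace.denseSeq (lipBall X) k, fun k => Subtype.coe_prop _,
    fun z z' c hc => ?_⟩
  obtain ⟨f, hf, hlt⟩ : ∃ f : X → ℝ, (∀ x y, |f x - f y| ≤ dist x y) ∧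
      c < ∫ x, f x ∂(z : Measure X) - ∫ x, f x ∂(z' : Measure X) := by
    by_contra! h
    exact hc.not_ge (priorDist_le h)
  obtain ⟨g, hg, hgf⟩ := exists_mem_lipBall_integral_sub_eq z z' hf
  rw [← hgf] at hlt
  -- Replacing `g` by `u k` costs at most their distance in each of two integrals, hence half of the
  -- gap.
  obtain ⟨k, hk⟩ := (TopologicalSpace.denseRange_denseSeq (lipBall X)).exists_dist_lt
    ⟨g, hg⟩ (half_pos (sub_pos.2 hlt))
  refine ⟨k, ?_⟩
  rw [Subtype.dist_eq] at hk
  have h1 := integral_le_integral_add_dist z g (TopologicalSpace.denseSeq (lipBall X) k)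
  have h2 := integral_le_integral_add_dist z' (TopologicalSpace.denseSeq (lipBall X) k) g
  rw [dist_comm] at h2
  simp only [] at hk
  linarith

/-- A finite `ε / 3`-net of `lipBall X` reduces the supremum over test functions to finitely many
weak neighbourhood conditions. -/
lemma eventually_priorDist_le (z₀ : ProbabilityMeasure X) {ε : ℝ} (hε : 0 < ε) :
    ∀ᶠ z in 𝓝 z₀, priorDist z z₀ ≤ ε := by
  obtain ⟨t, -, ht, hcov⟩ := isCompact_lipBall.finite_cover_balls (X := BoundedContinuousFunction X ℝ)
    (by positivity : 0 < ε / 3)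
  have hev : ∀ᶠ z : ProbabilityMeasure X in 𝓝 z₀, ∀ g ∈ t,
      ∫ x, g x ∂(z : Measure X) < ∫ x, g x ∂(z₀ : Measure X) + ε / 3 :=
    (eventually_all_finite ht).2 fun g _ =>
      ((ProbabilityMeasure.continuous_integral_boundedContinuousFunction g).tendsto z₀).eventually_lt_const
        (by linarith)
  filter_upwards [hev] with z hz
  refine priorDist_le fun f hf => ?_
  obtain ⟨g, hg, hgf⟩ := exists_mem_lipBall_integral_sub_eq z z₀ hf
  rw [← hgf]
  obtain ⟨h, hht, hgh⟩ := Set.mem_iUnion₂.1 (hcov hg)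
  rw [Metric.mem_ball] at hgh
  have h1 := integral_le_integral_add_dist z g h
  have h2 := integral_le_integral_add_dist z₀ h g
  rw [dist_comm] at h2
  linarith [hz h hht]

lemma continuous_of_sub_le_priorDist {f : ProbabilityMeasure X → ℝ} {c : ℝ}
    (hf : ∀ z z', f z - f z' ≤ c * priorDist z z') : Continuous f := by
  refine continuous_iff_continuousAt.2 fun z₀ => Metric.tendsto_nhds.2 fun ε hε => ?_
  have hc : 0 < |c| + 1 := by positivity
  filter_upwards [eventually_priorDist_le z₀ (ε := ε / 2 / (|c| + 1)) (by positivity)] with z hz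
  have h0 := priorDist_nonneg z z₀
  rw [le_div_iff₀ hc] at hz
  have hle : c * priorDist z z₀ ≤ ε / 2 := by nlinarith [le_abs_self c]
  have h1 := hf z z₀
  have h2 := hf z₀ z
  rw [priorDist_comm] at h2
  rw [Real.dist_eq, abs_lt]
  constructor <;> linarith

/-- Lipschitz functions detect weak convergence, so the constant sequence `μ` converges to `ν`;
limits are unique. -/
lemma ext_of_forall_lipschitzWith {S : Type*} [MetricSpace S] [MeasurableSpace S] [BorelSpace S]
    {μ ν : Measure S} [IsProbabilityMeasure μ] [IsProbabilityMeasure ν]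
    (h : ∀ (f : S → ℝ) (L : NNReal), LipschitzWith L f → ∫ x, f x ∂μ = ∫ x, f x ∂ν) : μ = ν := by
  let μ' : ProbabilityMeasure S := ⟨μ, inferInstance⟩
  let ν' : ProbabilityMeasure S := ⟨ν, inferInstance⟩
  have ht : Tendsto (fun _ : ℕ => μ') atTop (𝓝 ν') := by
    refine tendsto_iff_forall_lipschitz_integral_tendsto.2 fun f _ ⟨L, hL⟩ => ?_
    simpa only [μ', ν', ProbabilityMeasure.coe_mk, h f L hL] using tendsto_const_nhds
  exact congrArg ProbabilityMeasure.toMeasure (tendsto_nhds_unique tendsto_const_nhds ht)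

lemma eq_of_priorDist_eq_zero {z z' : ProbabilityMeasure X} (h : priorDist z z' = 0) : z = z' := by
  refine ProbabilityMeasure.toMeasure_injective (ext_of_forall_lipschitzWith fun f L hL => ?_)
  have hL1 : (0 : ℝ) < L + 1 := by positivity
  have hf : ∀ x y, |(L + 1 : ℝ)⁻¹ * f x - (L + 1 : ℝ)⁻¹ * f y| ≤ dist x y := fun x y => by
    rw [← mul_sub, abs_mul, abs_of_pos (inv_pos.2 hL1), inv_mul_le_iff₀ hL1, ← Real.dist_eq]
    refine (hL.dist_le_mul x y).trans ?_
    gcongr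
    linarith
  have h1 := integral_sub_integral_le_priorDist z z' hf
  have h2 := integral_sub_integral_le_priorDist z' z hf
  rw [priorDist_comm, h] at h2
  rw [h] at h1
  rw [integral_const_mul, integral_const_mul] at h1 h2
  exact mul_left_cancel₀ (inv_pos.2 hL1).ne' (by linarith)

/-- The σ-field on priors comes from evaluation on sets; its agreement with the Borel σ-field of the
weak topology makes continuous functions of the prior measurable. Evaluations at open sets are lower
semicontinuous, which gives one inclusion. For the other, countably many integrals embed the compact
space of priors into `ℕ → ℝ`. -/
instance : BorelSpace (ProbabilityMeasure X) := by
  constructor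
  apply le_antisymm
  · have hb : @Measurable _ _ (borel (ProbabilityMeasure X)) _
        (fun z : ProbabilityMeasure X => (z : Measure X)) := by
      let _ : MeasurableSpace (ProbabilityMeasure X) := borel _
      have _ : BorelSpace (ProbabilityMeasure X) := ⟨rfl⟩
      refine Measurable.measure_of_isPiSystem_of_isProbabilityMeasure
        (BorelSpace.measurable_eq (α := X)) isPiSystem_isOpen fun s hs => ?_
      refine LowerSemicontinuous.measurable ?_
      exact lowerSemicontinuous_iff_le_liminf.2 fun z =>
        ProbabilityMeasure.le_liminf_measure_open_of_tendsto tendsto_id hs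
    exact hb.comap_le
  · obtain ⟨u, hu, hsep⟩ := exists_countable_lipBall X
    let Φ : ProbabilityMeasure X → ℕ → ℝ := fun z k => ∫ x, u k x ∂(z : Measure X)
    have hΦ : Continuous Φ := continuous_pi fun k =>
      ProbabilityMeasure.continuous_integral_boundedContinuousFunction (u k)
    have hinj : Function.Injective Φ := by
      intro z z' h
      by_contra hne
      have hpos : 0 < priorDist z z' := (priorDist_nonneg z z').lt_of_ne'
        fun h0 => hne (eq_of_priorDist_eq_zero h0)
      obtain ⟨k, hk⟩ := hsep z z' 0 hpos
      exact absurd (congrFun h k) (by simp only [Φ]; linarith)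
    have hind := (hΦ.isClosedEmbedding hinj).isInducing
    have hm : Measurable Φ := measurable_pi_lambda _ fun k =>
      ((u k).continuous.stronglyMeasurable.integral_kernel (κ := evalKernel X)).measurable
    have hborel : borel (ProbabilityMeasure X) = MeasurableSpace.comap Φ MeasurableSpace.pi := by
      rw [hind.eq_induced, BorelSpace.measurable_eq (α := ℕ → ℝ), borel_comap]
    exact hborel.trans_le hm.comap_le

lemma eq_of_le_of_compactSpace_of_t2Space {S : Type*} {t s : TopologicalSpace S} (h : t ≤ s)
    (ht : @CompactSpace S t) (hs : @T2Space S s) : t = s :=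
  have hemb := @Continuous.isClosedEmbedding S S t s ht hs id (continuous_id_iff_le.2 h)
    Function.injective_id
  (@IsInducing.eq_induced S S t s id (@IsEmbedding.toIsInducing S S t s id
    (@IsClosedEmbedding.toIsEmbedding S S t s id hemb))).trans induced_id

/-- The Wasserstein distance metrizes the weak topology on the probability measures on a compact
metric space. -/
lemma exists_metricSpace_dist_eq_priorDist (X : Type*) [MetricSpace X] [CompactSpace X]
    [Nonempty X] [MeasurableSpace X] [BorelSpace X] :
    ∃ m : MetricSpace (ProbabilityMeasure X),
      m.toUniformSpace.toTopologicalSpace = ProbabilityMeasure.instTopologicalSpace ∧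
      ∀ z z', m.dist z z' = priorDist z z' := by
  let m : MetricSpace (ProbabilityMeasure X) :=
    { dist := priorDist
      dist_self := priorDist_self
      dist_comm := priorDist_comm
      dist_triangle := priorDist_triangle
      eq_of_dist_eq_zero := eq_of_priorDist_eq_zero }
  -- Only one comparison of topologies is needed: a compact topology finer than a Hausdorff one
  -- equals it.
  refine ⟨m, Eq.symm (eq_of_le_of_compactSpace_of_t2Space ?_ inferInstance ?_), fun _ _ => rfl⟩
  · refine le_of_nhds_le_nhds fun z₀ => ?_
    refine (@Metric.nhds_basis_closedBall _ m.toPseudoMetricSpace z₀).ge_iff.2 fun ε hε => ?_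
    exact eventually_priorDist_le z₀ hε
  · infer_instance

lemma ext_of_forall_sub_le_priorDist {μ ν : Measure (ProbabilityMeasure X)}
    [IsProbabilityMeasure μ] [IsProbabilityMeasure ν]
    (h : ∀ (f : ProbabilityMeasure X → ℝ) (c : ℝ), 0 ≤ c →
      (∀ z z', f z - f z' ≤ c * priorDist z z') → ∫ z, f z ∂μ = ∫ z, f z ∂ν) : μ = ν := by
  obtain ⟨m, hm, hdist⟩ := exists_metricSpace_dist_eq_priorDist X
  have hB : @BorelSpace (ProbabilityMeasure X) m.toUniformSpace.toTopologicalSpace _ := by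
    rw [hm]; infer_instance
  refine @ext_of_forall_lipschitzWith _ m _ hB μ ν _ _ fun f L hL => h f L L.2 fun z z' => ?_
  rw [← hdist]
  exact (le_abs_self _).trans (@LipschitzWith.dist_le_mul _ _ m.toPseudoMetricSpace _ _ _ hL z z')

end PriorDist


/-! ### Integrals against the joint law and the filter update -/

section Disintegration

variable {X Y : Type*} [MeasurableSpace X] [MeasurableSpace Y]

lemma integral_predictor (T : Kernel X X) [IsMarkovKernel T] (z : ProbabilityMeasure X)
    {g : X → ℝ} (hg : Measurable g) {c : ℝ} (hb : ∀ x, |g x| ≤ c) :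
    ∫ x, g x ∂predictor T z = ∫ x, ∫ x', g x' ∂T x ∂(z : Measure X) :=
  Kernel.integral_comp (κ := evalKernel X) (η := T) (a := z)
    (integrable_of_abs_le (μ := predictor T z) hg hb)

lemma integral_comp_predictor (T : Kernel X X) [IsMarkovKernel T] (Q : Kernel X Y)
    [IsMarkovKernel Q] (z : ProbabilityMeasure X) {g : Y → ℝ} (hg : Measurable g) {c : ℝ}
    (hb : ∀ y, |g y| ≤ c) :
    ∫ y, g y ∂(Q ∘ₖ predictor T) z = ∫ x, ∫ y, g y ∂Q x ∂predictor T z :=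
  Kernel.integral_comp (integrable_of_abs_le hg hb)

lemma integral_jointLaw (T : Kernel X X) [IsMarkovKernel T] (Q : Kernel X Y)
    [IsMarkovKernel Q] (z : ProbabilityMeasure X) {g : Y × X → ℝ} (hg : Measurable g) {c : ℝ}
    (hb : ∀ p, |g p| ≤ c) :
    ∫ p, g p ∂jointLaw T Q z = ∫ x, ∫ y, g (y, x) ∂Q x ∂predictor T z := by
  rw [jointLaw, Kernel.map_apply _ measurable_swap,
    integral_map measurable_swap.aemeasurable hg.aestronglyMeasurable,
    integral_compProd (f := fun p : X × Y => g p.swap)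
      (integrable_of_abs_le (hg.comp measurable_swap) fun p => hb _)]
  rfl

lemma fst_jointLaw (T : Kernel X X) [IsMarkovKernel T] (Q : Kernel X Y) [IsMarkovKernel Q] :
    (jointLaw T Q).fst = Q ∘ₖ predictor T := by
  rw [jointLaw, ← Kernel.swapRight_eq, Kernel.fst_swapRight, Kernel.snd_compProd_prodMkLeft]

variable [StandardBorelSpace X] [Nonempty X] [MeasurableSpace.CountablyGenerated Y]

/-- Bayes' rule: the filter update disintegrates the joint law over its observation marginal. -/
lemma integral_jointLaw_eq_integral_filterUpdate (T : Kernel X X) [IsMarkovKernel T]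
    (Q : Kernel X Y) [IsMarkovKernel Q] (z : ProbabilityMeasure X) {g : Y × X → ℝ}
    (hg : Measurable g) {c : ℝ} (hb : ∀ p, |g p| ≤ c) :
    ∫ p, g p ∂jointLaw T Q z =
      ∫ y, ∫ x, g (y, x) ∂(filterUpdate T Q z y : Measure X) ∂(Q ∘ₖ predictor T) z := by
  rw [← fst_jointLaw]
  conv_lhs => rw [← (jointLaw T Q).disintegrate (jointLaw T Q).condKernel]
  exact integral_compProd (integrable_of_abs_le hg hb)

lemma measurable_filterUpdate_right (T : Kernel X X) [IsMarkovKernel T]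
    (Q : Kernel X Y) [IsMarkovKernel Q] (z : ProbabilityMeasure X) :
    Measurable (filterUpdate T Q z) :=
  (measurable_filterUpdate T Q).comp measurable_prodMk_left

lemma integral_filterKernel (T : Kernel X X) [IsMarkovKernel T]
    (Q : Kernel X Y) [IsMarkovKernel Q] (z : ProbabilityMeasure X) {f : ProbabilityMeasure X → ℝ}
    (hf : Measurable f) :
    ∫ w, f w ∂filterKernel T Q z = ∫ y, f (filterUpdate T Q z y) ∂(Q ∘ₖ predictor T) z :=
  integral_map (measurable_filterUpdate_right T Q z).aemeasurable hf.aestronglyMeasurable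

lemma measurable_integral_filterUpdate (T : Kernel X X) [IsMarkovKernel T]
    (Q : Kernel X Y) [IsMarkovKernel Q] (z : ProbabilityMeasure X) {g : Y × X → ℝ}
    (hg : Measurable g) :
    Measurable fun y => ∫ x, g (y, x) ∂(filterUpdate T Q z y : Measure X) :=
  (hg.stronglyMeasurable.integral_kernel_prod_right'
    (κ := (evalKernel X).comap _ (measurable_filterUpdate_right T Q z))).measurable

end Disintegration

/-! ### The filter kernel as a Wasserstein contraction -/

section Contraction

set_option linter.unusedSectionVars false

variable {X Y : Type*} [MetricSpace X] [CompactSpace X] [Nonempty X] [MeasurableSpace X]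
  [BorelSpace X] [MeasurableSpace Y]

lemma integral_sub_integral_le_tvDist {S : Type*} [MeasurableSpace S] (μ ν : Measure S)
    [IsProbabilityMeasure μ] [IsProbabilityMeasure ν] {g : S → ℝ} (hg : Measurable g)
    (hb : ∀ x, |g x| ≤ 1) : ∫ x, g x ∂μ - ∫ x, g x ∂ν ≤ tvDist μ ν := by
  refine le_csSup ⟨2, ?_⟩ ⟨g, hg, hb, rfl⟩
  rintro _ ⟨h, -, hh, rfl⟩
  linarith [(abs_le.1 (abs_integral_le_of_abs_le (μ := μ) hh)).2,
    (abs_le.1 (abs_integral_le_of_abs_le (μ := ν) hh)).1]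

/-- A kernel that is Lipschitz in total variation maps the Wasserstein distance to the total
variation distance. -/
lemma integral_predictor_sub_le (T : Kernel X X) [IsMarkovKernel T] {α : ℝ} (hα : 0 ≤ α)
    (hT : ∀ x x' : X, tvDist (T x) (T x') ≤ α * dist x x') (z z' : ProbabilityMeasure X)
    {g : X → ℝ} (hg : Measurable g) (hb : ∀ x, |g x| ≤ 1) :
    ∫ x, g x ∂predictor T z - ∫ x, g x ∂predictor T z' ≤ α * priorDist z z' := by
  rw [integral_predictor T z hg hb, integral_predictor T z' hg hb]
  have hle : ∀ x x', (∫ u, g u ∂T x) - ∫ u, g u ∂T x' ≤ α * dist x x' := fun x x' =>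
    (integral_sub_integral_le_tvDist _ _ hg hb).trans (hT x x')
  rcases hα.eq_or_lt with rfl | hα
  · have hm : Measurable fun x => ∫ u, g u ∂T x :=
      (hg.stronglyMeasurable.integral_kernel (κ := T)).measurable
    rw [zero_mul]
    exact integral_sub_integral_le_of_sub_le hm fun x x' => by simpa using hle x x'
  · have hlip : ∀ x x', |α⁻¹ * (∫ u, g u ∂T x) - α⁻¹ * ∫ u, g u ∂T x'| ≤ dist x x' :=
      fun x x' => by
        rw [← mul_sub, abs_mul, abs_of_pos (inv_pos.2 hα), inv_mul_le_iff₀ hα]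
        refine abs_sub_le_iff.2 ⟨hle x x', ?_⟩
        rw [dist_comm]
        exact hle x' x
    have := integral_sub_integral_le_priorDist z z' hlip
    rwa [integral_const_mul, integral_const_mul, ← mul_sub, inv_mul_le_iff₀ hα] at this

variable [MeasurableSpace.CountablyGenerated Y]

/-- Taking the least admissible index is measurable, since each index is admissible on a measurable
set. The strict inequality `c y < priorDist (Z y) (Z' y)` removes the need for an exact maximizer.
-/
lemma exists_measurable_selection (u : ℕ → BoundedContinuousFunction X ℝ)
    (hu : ∀ (z z' : ProbabilityMeasure X) (c : ℝ), c < priorDist z z' →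
      ∃ k, c < ∫ x, u k x ∂(z : Measure X) - ∫ x, u k x ∂(z' : Measure X))
    {Z Z' : Y → ProbabilityMeasure X} (hZ : Measurable Z) (hZ' : Measurable Z')
    {c : Y → ℝ} (hc : Measurable c) (hlt : ∀ y, c y < priorDist (Z y) (Z' y)) :
    ∃ k : Y → ℕ, Measurable k ∧ ∀ y, c y <
      ∫ x, u (k y) x ∂(Z y : Measure X) - ∫ x, u (k y) x ∂(Z' y : Measure X) := by
  classical
  have hex : ∀ y, ∃ k, c y <
      ∫ x, u k x ∂(Z y : Measure X) - ∫ x, u k x ∂(Z' y : Measure X) := fun y =>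
    hu _ _ _ (hlt y)
  refine ⟨fun y => Nat.find (hex y), measurable_find hex fun k => ?_, fun y => Nat.find_spec (hex y)⟩
  have hm := (ProbabilityMeasure.continuous_integral_boundedContinuousFunction (u k)).measurable
  exact measurableSet_lt hc ((hm.comp hZ).sub (hm.comp hZ'))

/-- On average over the observation, the filter updates started from two priors are close. -/
lemma integral_filterUpdate_sub_le (T : Kernel X X) [IsMarkovKernel T] (Q : Kernel X Y)
    [IsMarkovKernel Q] {τ : ℝ} {z z' : ProbabilityMeasure X}
    (hτ : ∀ g : X → ℝ, Measurable g → (∀ x, |g x| ≤ 1) →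
      ∫ x, g x ∂predictor T z - ∫ x, g x ∂predictor T z' ≤ τ)
    (hτ' : ∀ g : X → ℝ, Measurable g → (∀ x, |g x| ≤ 1) →
      ∫ x, g x ∂predictor T z' - ∫ x, g x ∂predictor T z ≤ τ)
    {g : Y × X → ℝ} (hg : Measurable g) {c : ℝ} (hc : 0 ≤ c) (hb : ∀ p, |g p| ≤ c) :
    ∫ y, (∫ x, g (y, x) ∂(filterUpdate T Q z y : Measure X) -
      ∫ x, g (y, x) ∂(filterUpdate T Q z' y : Measure X)) ∂(Q ∘ₖ predictor T) z ≤
      c * ((2 - dobrushin Q) * τ) := by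
  have hG := measurable_integral_filterUpdate T Q z hg
  have hG' := measurable_integral_filterUpdate T Q z' hg
  have hbG : ∀ (w : ProbabilityMeasure X) (y : Y),
      |∫ x, g (y, x) ∂(filterUpdate T Q w y : Measure X)| ≤ c := fun w y =>
    abs_integral_le_of_abs_le fun x => hb _
  rw [integral_sub (integrable_of_abs_le hG (hbG z)) (integrable_of_abs_le hG' (hbG z')),
    ← integral_jointLaw_eq_integral_filterUpdate T Q z hg hb]
  -- Both joint laws arise from the predictors through the same channel, so they are no further
  -- apart than the predictors.
  have hJ : ∫ p, g p ∂jointLaw T Q z - ∫ p, g p ∂jointLaw T Q z' ≤ c * τ := by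
    rw [integral_jointLaw T Q z hg hb, integral_jointLaw T Q z' hg hb]
    have hm : Measurable fun x => ∫ y, g (y, x) ∂Q x :=
      ((hg.comp measurable_swap).stronglyMeasurable.integral_kernel_prod_right'
        (κ := Q)).measurable
    exact integral_sub_integral_le_mul hτ hm hc fun x => abs_integral_le_of_abs_le fun y => hb _
  -- It remains to integrate the update from `z'` against the wrong observation law; here the
  -- channel gains the factor `1 - δ`.
  have hP := integral_sub_integral_le_mul (μ := (Q ∘ₖ predictor T) z')
    (ν := (Q ∘ₖ predictor T) z) (τ := (1 - dobrushin Q) * τ) (fun h hh hhb => by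
      rw [integral_comp_predictor T Q z' hh hhb, integral_comp_predictor T Q z hh hhb]
      exact integral_integral_sub_le_dobrushin Q hτ' hh hhb) hG' hc (hbG z')
  rw [integral_jointLaw_eq_integral_filterUpdate T Q z' hg hb] at hJ
  linarith

/-- The filter kernel is Lipschitz in the Wasserstein distance. -/
lemma integral_filterKernel_sub_le (T : Kernel X X) [IsMarkovKernel T] (Q : Kernel X Y)
    [IsMarkovKernel Q] {α : ℝ} (hα : 0 ≤ α)
    (hT : ∀ x x' : X, tvDist (T x) (T x') ≤ α * dist x x')
    {f : ProbabilityMeasure X → ℝ} (hf : ∀ z z', f z - f z' ≤ priorDist z z')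
    (z z' : ProbabilityMeasure X) :
    ∫ w, f w ∂filterKernel T Q z - ∫ w, f w ∂filterKernel T Q z' ≤
      α * Metric.diam (Set.univ : Set X) * (3 - 2 * dobrushin Q) / 2 * priorDist z z' := by
  set D := Metric.diam (Set.univ : Set X) with hD
  have hD0 : 0 ≤ D / 2 := div_nonneg Metric.diam_nonneg zero_le_two
  set τ := α * priorDist z z' with hτdef
  have hτ := fun (g : X → ℝ) (hg : Measurable g) (hb : ∀ x, |g x| ≤ 1) =>
    integral_predictor_sub_le T hα hT z z' hg hb
  have hτ' : ∀ g : X → ℝ, Measurable g → (∀ x, |g x| ≤ 1) →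
      ∫ x, g x ∂predictor T z' - ∫ x, g x ∂predictor T z ≤ τ := fun g hg hb => by
    rw [hτdef, priorDist_comm]
    exact integral_predictor_sub_le T hα hT z' z hg hb
  have hfm : Measurable f :=
    (continuous_of_sub_le_priorDist (c := 1) (by simpa using hf)).measurable
  have hosc : ∀ w w', f w - f w' ≤ D := fun w w' => (hf w w').trans (priorDist_le_diam w w')
  have hF := measurable_filterUpdate_right T Q z
  have hF' := measurable_filterUpdate_right T Q z'
  rw [integral_filterKernel T Q z hfm, integral_filterKernel T Q z' hfm]
  obtain ⟨C, hC⟩ := exists_abs_le_of_sub_le hosc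
  have hI : ∀ w w' : ProbabilityMeasure X,
      Integrable (fun y => f (filterUpdate T Q w' y)) ((Q ∘ₖ predictor T) w) := fun w w' =>
    integrable_of_abs_le (hfm.comp (measurable_filterUpdate_right T Q w')) fun y => hC _
  have hsecond : ∫ y, f (filterUpdate T Q z' y) ∂(Q ∘ₖ predictor T) z -
      ∫ y, f (filterUpdate T Q z' y) ∂(Q ∘ₖ predictor T) z' ≤
      D / 2 * ((1 - dobrushin Q) * τ) := by
    obtain ⟨m, hm⟩ := exists_abs_sub_le_half_of_sub_le hosc
    rw [← integral_sub_integral_sub_const (hI z z') (hI z' z') m]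
    refine integral_sub_integral_le_mul (fun h hh hhb => ?_)
      ((hfm.comp hF').sub_const m) hD0 fun y => hm _
    rw [integral_comp_predictor T Q z' hh hhb, integral_comp_predictor T Q z hh hhb]
    exact integral_integral_sub_le_dobrushin Q hτ hh hhb
  have hfirst : ∫ y, f (filterUpdate T Q z y) ∂(Q ∘ₖ predictor T) z -
      ∫ y, f (filterUpdate T Q z' y) ∂(Q ∘ₖ predictor T) z ≤
      D / 2 * ((2 - dobrushin Q) * τ) := by
    -- The slack `ε` makes the inequality strict, so that a test function can be selected measurably
    -- in `y`.
    refine le_of_forall_pos_le_add fun ε hε => ?_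
    obtain ⟨u, hu, hsep⟩ := exists_countable_lipBall X
    obtain ⟨k, hk, hlt⟩ := exists_measurable_selection u hsep hF hF'
      (c := fun y => f (filterUpdate T Q z y) - f (filterUpdate T Q z' y) - ε)
      (((hfm.comp hF).sub (hfm.comp hF')).sub_const ε)
      fun y => by linarith [hf (filterUpdate T Q z y) (filterUpdate T Q z' y)]
    have hg : Measurable fun p : Y × X => u (k p.1) p.2 :=
      (measurable_from_prod_countable_right (f := fun p : ℕ × X => u p.1 p.2)
        fun n => (u n).continuous.measurable).comp
        ((hk.comp measurable_fst).prodMk measurable_snd)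
    have hgb : ∀ p : Y × X, |u (k p.1) p.2| ≤ D / 2 := fun p => (hu _).2 _
    have hbound := integral_filterUpdate_sub_le T Q hτ hτ' hg hD0 hgb
    have hIu : ∀ w : ProbabilityMeasure X, Integrable
        (fun y => ∫ x, u (k y) x ∂(filterUpdate T Q w y : Measure X)) ((Q ∘ₖ predictor T) z) :=
      fun w => integrable_of_abs_le (measurable_integral_filterUpdate T Q w hg)
        fun y => abs_integral_le_of_abs_le fun x => hgb (y, x)
    have hmono := integral_mono
      (f := fun y => f (filterUpdate T Q z y) - f (filterUpdate T Q z' y) - ε)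
      (g := fun y => ∫ x, u (k y) x ∂(filterUpdate T Q z y : Measure X) -
        ∫ x, u (k y) x ∂(filterUpdate T Q z' y : Measure X))
      (((hI z z).sub (hI z z')).sub (integrable_const ε)) ((hIu z).sub (hIu z'))
      fun y => (hlt y).le
    rw [integral_sub (f := fun y => f (filterUpdate T Q z y) - f (filterUpdate T Q z' y))
        ((hI z z).sub (hI z z')) (integrable_const ε),
      integral_sub (hI z z) (hI z z'), integral_const, probReal_univ, one_smul] at hmono
    linarith [hmono.trans hbound]
  rw [show α * D * (3 - 2 * dobrushin Q) / 2 * priorDist z z' =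
    D / 2 * ((2 - dobrushin Q) * τ) + D / 2 * ((1 - dobrushin Q) * τ) by rw [hτdef]; ring]
  linarith

end Contraction


/-! ### Iterates of a Markov kernel -/

section StepLaw

variable {S : Type*} [MeasurableSpace S] (P : Kernel S S)

instance isMarkovKernel_pow [IsMarkovKernel P] (n : ℕ) : IsMarkovKernel (P ^ n) := by
  induction n with
  | zero => rw [pow_zero]; exact inferInstanceAs (IsMarkovKernel Kernel.id)
  | succ n ih => rw [pow_succ]; exact inferInstanceAs (IsMarkovKernel ((P ^ n) ∘ₖ P))

instance [IsMarkovKernel P] (n : ℕ) (μ : Measure S) [IsProbabilityMeasure μ] :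
    IsProbabilityMeasure (stepLaw P n μ) :=
  inferInstanceAs (IsProbabilityMeasure (μ.bind (P ^ n)))

lemma integral_bind_kernel {S' : Type*} [MeasurableSpace S'] (K : Kernel S S') [IsMarkovKernel K]
    (μ : Measure S) [IsProbabilityMeasure μ] {f : S' → ℝ} (hf : Measurable f) {c : ℝ}
    (hc : ∀ x, |f x| ≤ c) : ∫ y, f y ∂μ.bind K = ∫ x, ∫ y, f y ∂K x ∂μ := by
  have h := Kernel.integral_comp (κ := Kernel.const Unit μ) (η := K) (a := ())
    (integrable_of_abs_le (μ := (K ∘ₖ Kernel.const Unit μ) ()) hf hc)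
  rwa [Kernel.comp_apply, Kernel.const_apply] at h

lemma stepLaw_succ (n : ℕ) (μ : Measure S) : stepLaw P (n + 1) μ = (stepLaw P n μ).bind P := by
  rw [stepLaw, stepLaw, pow_succ', Measure.bind_bind (Kernel.measurable _).aemeasurable
    (Kernel.measurable _).aemeasurable]
  rfl

lemma stepLaw_succ' (n : ℕ) (μ : Measure S) : stepLaw P (n + 1) μ = stepLaw P n (μ.bind P) := by
  rw [stepLaw, stepLaw, pow_succ, Measure.bind_bind (Kernel.measurable _).aemeasurable
    (Kernel.measurable _).aemeasurable]
  rfl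

lemma stepLaw_eq_of_invariant {μ : Measure S} (h : P.Invariant μ) (n : ℕ) :
    stepLaw P n μ = μ := by
  induction n with
  | zero => rw [stepLaw, pow_zero]; exact Measure.bind_dirac
  | succ n ih => rw [stepLaw_succ, ih]; exact h

end StepLaw

/-! ### Invariant measure and geometric ergodicity of a contraction -/

section Ergodicity

variable {X : Type*} [MetricSpace X] [CompactSpace X] [Nonempty X] [MeasurableSpace X]
  [BorelSpace X] {P : Kernel (ProbabilityMeasure X) (ProbabilityMeasure X)} [IsMarkovKernel P]
  {β : ℝ}

lemma exists_abs_le_of_sub_le_priorDist {f : ProbabilityMeasure X → ℝ} {c : ℝ} (hc : 0 ≤ c)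
    (hf : ∀ z z', f z - f z' ≤ c * priorDist z z') : ∃ C, ∀ z, |f z| ≤ C :=
  exists_abs_le_of_sub_le (c := c * Metric.diam (Set.univ : Set X)) fun z z' =>
    (hf z z').trans (mul_le_mul_of_nonneg_left (priorDist_le_diam z z') hc)

lemma integral_sub_le_mul_priorDist
    (hP : ∀ f : ProbabilityMeasure X → ℝ, (∀ z z', f z - f z' ≤ priorDist z z') →
      ∀ z z', ∫ w, f w ∂P z - ∫ w, f w ∂P z' ≤ β * priorDist z z')
    {f : ProbabilityMeasure X → ℝ} {c : ℝ} (hc : 0 ≤ c)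
    (hf : ∀ z z', f z - f z' ≤ c * priorDist z z') (z z' : ProbabilityMeasure X) :
    ∫ w, f w ∂P z - ∫ w, f w ∂P z' ≤ c * β * priorDist z z' := by
  rcases hc.eq_or_lt with rfl | hc
  · simp only [zero_mul] at hf ⊢
    exact integral_sub_integral_le_of_sub_le
      (continuous_of_sub_le_priorDist (c := 0) (by simpa using hf)).measurable hf
  · have h := hP (fun w => c⁻¹ * f w) (fun w w' => by
      rw [← mul_sub, inv_mul_le_iff₀ hc]; exact hf w w') z z'
    rw [integral_const_mul, integral_const_mul, ← mul_sub, inv_mul_le_iff₀ hc] at h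
    rwa [mul_assoc]

/-- Each application of `P` multiplies the Lipschitz constant of a test function by `β`. -/
lemma integral_pow_sub_le_mul_priorDist (hβ : 0 ≤ β)
    (hP : ∀ f : ProbabilityMeasure X → ℝ, (∀ z z', f z - f z' ≤ priorDist z z') →
      ∀ z z', ∫ w, f w ∂P z - ∫ w, f w ∂P z' ≤ β * priorDist z z')
    {f : ProbabilityMeasure X → ℝ} {c : ℝ} (hc : 0 ≤ c)
    (hf : ∀ z z', f z - f z' ≤ c * priorDist z z') (n : ℕ) (z z' : ProbabilityMeasure X) :
    ∫ w, f w ∂(P ^ n) z - ∫ w, f w ∂(P ^ n) z' ≤ c * β ^ n * priorDist z z' := by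
  induction n generalizing z z' with
  | zero =>
    have hid : P ^ 0 = Kernel.id := pow_zero P
    have hm := (continuous_of_sub_le_priorDist hf).stronglyMeasurable
    rw [hid, Kernel.id_apply, Kernel.id_apply, integral_dirac' _ _ hm, integral_dirac' _ _ hm,
      pow_zero, mul_one]
    exact hf z z'
  | succ n ih =>
    obtain ⟨C, hC⟩ := exists_abs_le_of_sub_le_priorDist hc hf
    have hstep : ∀ z, ∫ w, f w ∂(P ^ (n + 1)) z = ∫ w, ∫ v, f v ∂(P ^ n) w ∂P z := fun z => by
      rw [pow_succ]
      exact Kernel.integral_comp (κ := P) (η := P ^ n)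
        (integrable_of_abs_le (μ := ((P ^ n) ∘ₖ P) z)
          (continuous_of_sub_le_priorDist hf).measurable hC)
    rw [hstep, hstep, pow_succ, ← mul_assoc]
    exact integral_sub_le_mul_priorDist hP (mul_nonneg hc (pow_nonneg hβ n)) ih z z'

/-- After `n` steps the test function has oscillation at most `c * β ^ n * D`, whatever the two
initial laws are. -/
lemma integral_stepLaw_sub_le (hβ : 0 ≤ β)
    (hP : ∀ f : ProbabilityMeasure X → ℝ, (∀ z z', f z - f z' ≤ priorDist z z') →
      ∀ z z', ∫ w, f w ∂P z - ∫ w, f w ∂P z' ≤ β * priorDist z z')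
    (μ ν : Measure (ProbabilityMeasure X)) [IsProbabilityMeasure μ] [IsProbabilityMeasure ν]
    {f : ProbabilityMeasure X → ℝ} {c : ℝ} (hc : 0 ≤ c)
    (hf : ∀ z z', f z - f z' ≤ c * priorDist z z') (n : ℕ) :
    ∫ w, f w ∂stepLaw P n μ - ∫ w, f w ∂stepLaw P n ν ≤
      c * (β ^ n * Metric.diam (Set.univ : Set X)) := by
  obtain ⟨C, hC⟩ := exists_abs_le_of_sub_le_priorDist hc hf
  have hfm := (continuous_of_sub_le_priorDist hf).measurable
  have hpow := integral_pow_sub_le_mul_priorDist hβ hP hc hf n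
  rw [stepLaw, stepLaw, integral_bind_kernel _ μ hfm hC, integral_bind_kernel _ ν hfm hC]
  refine integral_sub_integral_le_of_sub_le (continuous_of_sub_le_priorDist hpow).measurable
    fun z z' => (hpow z z').trans ?_
  rw [← mul_assoc]
  exact mul_le_mul_of_nonneg_left (priorDist_le_diam z z') (mul_nonneg hc (pow_nonneg hβ n))

lemma W1_stepLaw_le (hβ : 0 ≤ β)
    (hP : ∀ f : ProbabilityMeasure X → ℝ, (∀ z z', f z - f z' ≤ priorDist z z') →
      ∀ z z', ∫ w, f w ∂P z - ∫ w, f w ∂P z' ≤ β * priorDist z z')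
    (μ ν : Measure (ProbabilityMeasure X)) [IsProbabilityMeasure μ] [IsProbabilityMeasure ν]
    (n : ℕ) : W1 priorDist (stepLaw P n μ) (stepLaw P n ν) ≤
      β ^ n * Metric.diam (Set.univ : Set X) := by
  refine csSup_le ⟨_, fun _ => 0, fun z z' => by simpa using priorDist_nonneg z z', rfl⟩ ?_
  rintro _ ⟨f, hf, rfl⟩
  simpa using integral_stepLaw_sub_le hβ hP μ ν zero_le_one
    (fun z z' => by simpa using (le_abs_self _).trans (hf z z')) n

/-- The laws of the chain started at `z₀` have a weak limit point along an ultrafilter. Integrating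
against `P` keeps test functions Lipschitz, so one more step passes to the limit; consecutive laws
merge, so that step changes nothing. -/
lemma exists_invariant (hβ : 0 ≤ β) (hβ1 : β < 1)
    (hP : ∀ f : ProbabilityMeasure X → ℝ, (∀ z z', f z - f z' ≤ priorDist z z') →
      ∀ z z', ∫ w, f w ∂P z - ∫ w, f w ∂P z' ≤ β * priorDist z z') :
    ∃ π : ProbabilityMeasure (ProbabilityMeasure X),
      P.Invariant (π : Measure (ProbabilityMeasure X)) := by
  obtain ⟨z₀⟩ : Nonempty (ProbabilityMeasure X) := inferInstance
  let u : ℕ → ProbabilityMeasure (ProbabilityMeasure X) := fun n =>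
    ⟨stepLaw P n (Measure.dirac z₀), inferInstance⟩
  obtain ⟨π, -, hπ⟩ := isCompact_univ.ultrafilter_le_nhds ((hyperfilter ℕ).map u) (by simp)
  have hu : Tendsto u (hyperfilter ℕ) (𝓝 π) := hπ
  have hlim : ∀ (f : ProbabilityMeasure X → ℝ) (c : ℝ), 0 ≤ c →
      (∀ z z', f z - f z' ≤ c * priorDist z z') →
      Tendsto (fun n => ∫ z, f z ∂stepLaw P n (Measure.dirac z₀)) (hyperfilter ℕ)
        (𝓝 (∫ z, f z ∂(π : Measure (ProbabilityMeasure X)))) := fun f c hc hf =>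
    ProbabilityMeasure.tendsto_iff_forall_integral_tendsto.1 hu
      (BoundedContinuousFunction.mkOfCompact ⟨f, continuous_of_sub_le_priorDist hf⟩)
  refine ⟨π, ext_of_forall_sub_le_priorDist fun f c hc hf => ?_⟩
  obtain ⟨C, hC⟩ := exists_abs_le_of_sub_le_priorDist hc hf
  have hfm := (continuous_of_sub_le_priorDist hf).measurable
  rw [integral_bind_kernel P _ hfm hC]
  have h1 := hlim _ _ (mul_nonneg hc hβ) (integral_sub_le_mul_priorDist hP hc hf)
  have h2 := (h1.sub (hlim f c hc hf))
  simp only [← integral_bind_kernel P (stepLaw P _ _) hfm hC, ← stepLaw_succ] at h2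
  have h3 : Tendsto (fun n => c * (β ^ n * Metric.diam (Set.univ : Set X))) (hyperfilter ℕ)
      (𝓝 0) := by
    have := ((tendsto_pow_atTop_nhds_zero_of_lt_one hβ hβ1).mul_const
      (Metric.diam (Set.univ : Set X))).const_mul c
    rw [zero_mul, mul_zero] at this
    exact this.mono_left Nat.hyperfilter_le_atTop
  have h4 : Tendsto (fun n => ∫ z, f z ∂stepLaw P (n + 1) (Measure.dirac z₀) -
      ∫ z, f z ∂stepLaw P n (Measure.dirac z₀)) (hyperfilter ℕ) (𝓝 0) := by
    -- The law after `n + 1` steps is the `n`-step law started from the one-step law, so the bound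
    -- for two initial laws applies.
    refine squeeze_zero_norm (fun n => ?_) h3
    rw [Real.norm_eq_abs, stepLaw_succ', abs_sub_le_iff]
    exact ⟨integral_stepLaw_sub_le hβ hP _ _ hc hf n, integral_stepLaw_sub_le hβ hP _ _ hc hf n⟩
  exact sub_eq_zero.1 (tendsto_nhds_unique h2 h4)

lemma geometricallyWassersteinErgodic_of_invariant (hβ : 0 ≤ β) (hβ1 : β < 1)
    (hP : ∀ f : ProbabilityMeasure X → ℝ, (∀ z z', f z - f z' ≤ priorDist z z') →
      ∀ z z', ∫ w, f w ∂P z - ∫ w, f w ∂P z' ≤ β * priorDist z z')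
    {π : ProbabilityMeasure (ProbabilityMeasure X)}
    (hπ : P.Invariant (π : Measure (ProbabilityMeasure X))) :
    GeometricallyWassersteinErgodic priorDist P := by
  have hpos : 0 < 1 + β := by linarith
  -- Any `ρ > 1` with `ρ * β < 1` would do; this choice also covers `β = 0`.
  refine ⟨π, 2 / (1 + β), by rw [one_lt_div hpos]; linarith, ?_⟩
  have hr0 : 0 ≤ 2 / (1 + β) * β := by positivity
  have hr1 : 2 / (1 + β) * β < 1 := by rw [div_mul_eq_mul_div, div_lt_one hpos]; linarith
  have hlim : Tendsto (fun n : ℕ => ENNReal.ofReal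
      ((2 / (1 + β) * β) ^ n * Metric.diam (Set.univ : Set X))) atTop (𝓝 0) := by
    have := ENNReal.tendsto_ofReal ((tendsto_pow_atTop_nhds_zero_of_lt_one hr0 hr1).mul_const
      (Metric.diam (Set.univ : Set X)))
    rwa [zero_mul, ENNReal.ofReal_zero] at this
  refine tendsto_of_tendsto_of_tendsto_of_le_of_le tendsto_const_nhds hlim (fun n => zero_le)
    fun n => iSup_le fun z => ENNReal.ofReal_le_ofReal ?_
  have := W1_stepLaw_le hβ hP (Measure.dirac z) (π : Measure (ProbabilityMeasure X)) n
  rw [stepLaw_eq_of_invariant P hπ] at this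
  rw [mul_pow, mul_assoc]
  exact mul_le_mul_of_nonneg_left this (by positivity)

end Ergodicity

end NonlinearFilter

theorem theorem2p1 {X Y : Type*}
    [MetricSpace X] [CompactSpace X] [Nonempty X] [MeasurableSpace X] [BorelSpace X]
    [TopologicalSpace Y] [PolishSpace Y] [MeasurableSpace Y] [BorelSpace Y]
    (T : Kernel X X) [IsMarkovKernel T] (Q : Kernel X Y) [IsMarkovKernel Q]
    (α : ℝ) (hα : 0 ≤ α)
    (hT : ∀ x x' : X, NonlinearFilter.tvDist (T x) (T x') ≤ α * dist x x')
    (hQ : α * Metric.diam (Set.univ : Set X) * (3 - 2 * NonlinearFilter.dobrushin Q) < 2) :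
    NonlinearFilter.GeometricallyWassersteinErgodic NonlinearFilter.priorDist
        (NonlinearFilter.filterKernel T Q) ∧
      (∃ π : ProbabilityMeasure (ProbabilityMeasure X),
        (NonlinearFilter.filterKernel T Q).Invariant (π : Measure (ProbabilityMeasure X))) ∧
      (∀ (μ ν : ProbabilityMeasure (ProbabilityMeasure X)) (n : ℕ),
        NonlinearFilter.W1 NonlinearFilter.priorDist
            (NonlinearFilter.stepLaw (NonlinearFilter.filterKernel T Q) n μ)
            (NonlinearFilter.stepLaw (NonlinearFilter.filterKernel T Q) n ν) ≤
          (α * Metric.diam (Set.univ : Set X) * (3 - 2 * NonlinearFilter.dobrushin Q) / 2) ^ n *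
            Metric.diam (Set.univ : Set X)) := by
  have hβ : 0 ≤ α * Metric.diam (Set.univ : Set X) * (3 - 2 * NonlinearFilter.dobrushin Q) / 2 := by
    have h1 := NonlinearFilter.dobrushin_le_one Q
    have h2 : 0 ≤ 3 - 2 * NonlinearFilter.dobrushin Q := by linarith
    have h3 : 0 ≤ Metric.diam (Set.univ : Set X) := Metric.diam_nonneg
    positivity
  have hβ1 : α * Metric.diam (Set.univ : Set X) * (3 - 2 * NonlinearFilter.dobrushin Q) / 2 < 1 := by
    linarith
  have hP := fun (f : ProbabilityMeasure X → ℝ)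
      (hf : ∀ z z', f z - f z' ≤ NonlinearFilter.priorDist z z') =>
    NonlinearFilter.integral_filterKernel_sub_le T Q hα hT hf
  obtain ⟨π, hπ⟩ := NonlinearFilter.exists_invariant hβ hβ1 hP
  exact ⟨NonlinearFilter.geometricallyWassersteinErgodic_of_invariant hβ hβ1 hP hπ, ⟨π, hπ⟩,
    fun μ ν n => NonlinearFilter.W1_stepLaw_le hβ hP μ ν n⟩
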